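/- **Definitions.** A *form* over a category $\mathbb{C}$ is a faithful functor $F\colon\mathbb{B}\to\mathbb{C}$ that is amnestic (the only isomorphisms it maps to identities are identities). The objects $A$ of $\mathbb{B}$ with $F(A)=X$ are the *clusters* in $X$; for $f\colon X\to Y$ we write $A\le_f B$ if some morphism $A\to B$ of $\mathbb{B}$ is mapped to $f$, and $\le$ for $\le_{1_X}$, a partial order on the clusters in $X$. Two forms over $\mathbb C$ are isomorphic if there are bijections between their clusters in each object that preserve and reflect all relations $\le_f$. The form $F$ is *orean* if the clusters in each object form a bounded lattice, $A\le_{gf}D$ implies $A\le_f B\le_g D$ for some $B$, and for $f\colon X\to Y$ the direct image $f\cdot S=\min\{T\mid S\le_f T\}$ and the inverse image $T\cdot f=\max\{S\mid S\le_f T\}$ always exist. Then $\operatorname{Im}f=f\cdot\top$ and $\operatorname{Ker}f=\bot\cdot f$; a cluster is *conormal* (*normal*) if it is the image (kernel) of some morphism; $F$ is conormal (normal) if all its clusters are, and *binormal* if it is both. An *embedding* of a conormal cluster $S$ is a morphism $m$ with $\operatorname{Im}m=S$ through which every $f'$ with the same codomain and $\operatorname{Im}f'\le S$ factors uniquely;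 a *quotient* of a normal cluster is defined dually. Consider the axioms - (N1) for all $f\colon X\to Y$, $(f\cdot S)\cdot f=S\vee\operatorname{Ker}f$ for all clusters $S$ in $X$, and $f\cdot(T\cdot f)=T\wedge\operatorname{Im}f$ for all clusters $T$ in $Y$; - (N2) every morphism $f$ is a quotient of $\operatorname{Ker}f$ followed by an embedding of $\operatorname{Im}f$; - (N3) joins of two normal clusters are normal and meets of two conormal clusters are conormal. An orean form is *noetherian* if it satisfies (N1), (N2) and (N3). An *operator* $F\to G$ maps $F$-clusters in each $X$ to $G$-clusters in $X$, preserving all relations $\le_f$; between orean forms it is *conormal* (*normal*) if it preserves images (kernels) of morphisms, and *binormal* if both. For an idempotent operator $\kappa$ on $F$, let $F_\kappa$ be the subform of clusters $S$ with $\kappa S=S$. A *decomposition* of an orean form $F$ is a pair $(\kappa_s,\kappa_e)$ of idempotent operators on $F$ such that $F_s=F_{\kappa_s}$ is a conormal orean form, $F_e=F_{\kappa_e}$ is a normal orean form, and for one of the six bounded lattice terms $t(x,y)\in\{\top,\bot,x,y,x\vee y,x\wedge y\}$ (a *decomposing term*) we have $S=t(\kappa_sS,\kappa_eS)$ for all clusters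 $S$. It is a *right* decomposition if $t=y$ is a decomposing term and a *meet* decomposition if $t=x\wedge y$ is one. It is *exact* if the restrictions $F\to F_s$ and $F\to F_e$ of $\kappa_s$ and $\kappa_e$ are binormal, there exist a conormal operator $F_s\to F_e$ and a normal operator $F_e\to F_s$, the inclusion $F_s\to F$ is conormal and the inclusion $F_e\to F$ is normal. A *right exact meet decomposition* is an exact decomposition that is both a right and a meet decomposition. A pointed category is *Puppe–Mitchell exact* if it has kernels and cokernels and every morphism is a cokernel followed by a kernel. A category with a class $\mathcal N$ of morphisms is *Grandis exact* if $\mathcal N$ is an ideal (closed under composition with arbitrary morphisms on either side) in which every member factors through an identity morphism in $\mathcal N$, kernels and cokernels relative to $\mathcal N$ exist, and every morphism is a cokernel followed by a kernel relative to $\mathcal N$. The *form of normal subobjects* has as clusters in $X$ the subobjects of $X$ represented by kernels (relative to $\mathcal N$ in the Grandis case), and $S\le_fT$ if $f\circ s$ factors through $t$ for $s,t$ representing $S,T$. **Theorem.** Let $F$ be an orean form over a pointed category $\mathbb{C}$ (a category with a zero object). Then $\mathbb{C}$ is Puppe–Mitchell exact if and only if $(\mathbb{C},\mathcal N)$ is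 Grandis exact for some $\mathcal N$, and the following conditions are equivalent: - (i) $\mathbb{C}$ is Puppe–Mitchell exact and $F$ is isomorphic to its form of normal subobjects; or, equivalently, $(\mathbb{C},\mathcal N)$ is Grandis exact for some $\mathcal N$, and $F$ is isomorphic to its form of normal subobjects; - (ii) $F$ is a binormal noetherian form; - (iii) $F$ is a normal noetherian form admitting an exact meet decomposition; - (iv) $F$ is a noetherian form admitting a right exact meet decomposition; - (v) $F$ satisfies (N2) and admits a right exact meet decomposition; - (vi) $F$ is normal, satisfies (N2) and admits an exact meet decomposition; - (vii) $F$ is binormal and satisfies (N2). -/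

import Mathlib

open CategoryTheory CategoryTheory.Limits

universe w w' v u v₁ u₁

namespace FormTheory

/-! ### Cluster systems and forms -/

/-- A cluster system over a category: a type of clusters in every object and, for every morphism
`f : X ⟶ Y`, a relation `le f A B` (written `B ≥_f A` in the literature) between clusters in `X`
and clusters in `Y`. -/
structure ClusterSystem (C : Type u) [Category.{v} C] where
  Cluster : C → Type w
  le : ∀ {X Y : C}, (X ⟶ Y) → Cluster X → Cluster Y → Prop
  le_refl : ∀ {X : C} (S : Cluster X), le (𝟙 X) S S
  le_comp : ∀ {X Y Z : C} (f : X ⟶ Y) (g : Y ⟶ Z) (A : Cluster X) (B : Cluster Y) (D : Cluster Z),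
    le f A B → le g B D → le (f ≫ g) A D
  le_antisymm : ∀ {X : C} (S T : Cluster X), le (𝟙 X) S T → le (𝟙 X) T S → S = T

/-- A form over `C` is a faithful amnestic functor into `C`: the only isomorphisms mapped to
identity morphisms are identity morphisms. -/
class IsForm {B : Type u₁} [Category.{v₁} B] {C : Type u} [Category.{v} C] (F : B ⥤ C) :
    Prop where
  faithful : F.Faithful
  amnestic : ∀ {A A' : B} (i : A ≅ A') (X : C), F.IsHomLift (𝟙 X) i.hom →
    ∃ h : A = A', i.hom = eqToHom h

/-- The canonical presentation of a form `F : B ⥤ C` by a cluster system: the clusters in `X` are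
the objects `A` of `B` with `F A = X`, and `A ≤_f A'` means that some morphism `A ⟶ A'` of `B` is
mapped to `f` by `F`. -/
def clusters {B : Type u₁} [Category.{v₁} B] {C : Type u} [Category.{v} C] (F : B ⥤ C)
    [hF : IsForm F] : ClusterSystem.{u₁} C where
  Cluster X := {A : B // F.obj A = X}
  le f A A' := ∃ φ : A.1 ⟶ A'.1, F.IsHomLift f φ
  le_refl S := ⟨𝟙 _, IsHomLift.id S.2⟩
  le_comp := by
    rintro X Y Z f g A A' A'' ⟨φ, hφ⟩ ⟨ψ, hψ⟩
    exact ⟨φ ≫ ψ, inferInstance⟩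
  le_antisymm := by
    rintro X ⟨A, hA⟩ ⟨A', hA'⟩ ⟨φ, hφ⟩ ⟨ψ, hψ⟩
    dsimp only at φ ψ hφ hψ
    have := hF.faithful
    have h1 : φ ≫ ψ = 𝟙 A := F.map_injective (by
      have h := IsHomLift.fac' F (𝟙 X) (φ ≫ ψ)
      simpa using h)
    have h2 : ψ ≫ φ = 𝟙 A' := F.map_injective (by
      have h := IsHomLift.fac' F (𝟙 X) (ψ ≫ φ)
      simpa using h)
    obtain ⟨h, -⟩ := hF.amnestic (⟨φ, ψ, h1, h2⟩ : A ≅ A') X hφ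
    exact Subtype.ext h

variable {C : Type u} [Category.{v} C]

namespace ClusterSystem

/-- The clusters in an object are ordered by `le (𝟙 X)`. -/
instance (P : ClusterSystem.{w} C) (X : C) : PartialOrder (P.Cluster X) where
  le S T := P.le (𝟙 X) S T
  le_refl := P.le_refl
  le_trans S T U h h' := by
    have h'' := P.le_comp (𝟙 X) (𝟙 X) S T U h h'
    rwa [Category.comp_id] at h''
  le_antisymm := P.le_antisymm

/-- Isomorphism of cluster systems, i.e. of the forms that they present. -/
structure Iso (P : ClusterSystem.{w} C) (Q : ClusterSystem.{w'} C) where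
  equiv : ∀ X : C, P.Cluster X ≃ Q.Cluster X
  le_iff : ∀ {X Y : C} (f : X ⟶ Y) (A : P.Cluster X) (B : P.Cluster Y),
    P.le f A B ↔ Q.le f (equiv X A) (equiv Y B)

/-! ### Orean forms -/

/-- Orean: the clusters in each object form a bounded lattice, every relation `≤_{gf}` is the
composite of `≤_f` and `≤_g`, and direct and inverse images exist. -/
class IsOrean (P : ClusterSystem.{w} C) : Prop where
  exists_top : ∀ X : C, ∃ T : P.Cluster X, IsTop T
  exists_bot : ∀ X : C, ∃ T : P.Cluster X, IsBot T
  exists_sup : ∀ {X : C} (S T : P.Cluster X), ∃ U, IsLUB {S, T} U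
  exists_inf : ∀ {X : C} (S T : P.Cluster X), ∃ U, IsGLB {S, T} U
  exists_between : ∀ {X Y Z : C} (f : X ⟶ Y) (g : Y ⟶ Z) (A : P.Cluster X) (D : P.Cluster Z),
    P.le (f ≫ g) A D → ∃ B : P.Cluster Y, P.le f A B ∧ P.le g B D
  exists_direct : ∀ {X Y : C} (f : X ⟶ Y) (S : P.Cluster X), ∃ T, IsLeast {T | P.le f S T} T
  exists_inverse : ∀ {X Y : C} (f : X ⟶ Y) (T : P.Cluster Y), ∃ S, IsGreatest {S | P.le f S T} S

noncomputable instance (P : ClusterSystem.{w} C) [h : P.IsOrean] (X : C) :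
    Lattice (P.Cluster X) where
  sup S T := (h.exists_sup S T).choose
  inf S T := (h.exists_inf S T).choose
  le_sup_left S T := (h.exists_sup S T).choose_spec.1 (by simp)
  le_sup_right S T := (h.exists_sup S T).choose_spec.1 (by simp)
  sup_le S T U hS hT := (h.exists_sup S T).choose_spec.2 (by
    rintro V (rfl | rfl)
    exacts [hS, hT])
  inf_le_left S T := (h.exists_inf S T).choose_spec.1 (by simp)
  inf_le_right S T := (h.exists_inf S T).choose_spec.1 (by simp)
  le_inf S T U hT hU := (h.exists_inf T U).choose_spec.2 (by
    rintro V (rfl | rfl)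
    exacts [hT, hU])

noncomputable instance (P : ClusterSystem.{w} C) [h : P.IsOrean] (X : C) :
    BoundedOrder (P.Cluster X) where
  top := (h.exists_top X).choose
  le_top := (h.exists_top X).choose_spec
  bot := (h.exists_bot X).choose
  bot_le := (h.exists_bot X).choose_spec

section Orean

variable (P : ClusterSystem.{w} C) [hP : P.IsOrean]

/-- The direct image `f · S`. -/
noncomputable def direct {X Y : C} (f : X ⟶ Y) (S : P.Cluster X) : P.Cluster Y :=
  (hP.exists_direct f S).choose

/-- The inverse image `T · f`. -/
noncomputable def inverse {X Y : C} (f : X ⟶ Y) (T : P.Cluster Y) : P.Cluster X :=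
  (hP.exists_inverse f T).choose

/-- The image of a morphism: the direct image of the top cluster. -/
noncomputable def im {X Y : C} (f : X ⟶ Y) : P.Cluster Y := P.direct f ⊤

/-- The kernel of a morphism: the inverse image of the bottom cluster. -/
noncomputable def ker {X Y : C} (f : X ⟶ Y) : P.Cluster X := P.inverse f ⊥

def IsConormalCluster {X : C} (S : P.Cluster X) : Prop := ∃ (W : C) (f : W ⟶ X), P.im f = S

def IsNormalCluster {X : C} (S : P.Cluster X) : Prop := ∃ (Y : C) (g : X ⟶ Y), P.ker g = S

/-- Every cluster is conormal. -/
def IsConormal : Prop := ∀ (X : C) (S : P.Cluster X), P.IsConormalCluster S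

/-- Every cluster is normal. -/
def IsNormal : Prop := ∀ (X : C) (S : P.Cluster X), P.IsNormalCluster S

def IsBinormal : Prop := P.IsNormal ∧ P.IsConormal

/-- `f` is an embedding of the (conormal) cluster `S`. -/
def IsEmbedding {W X : C} (S : P.Cluster X) (f : W ⟶ X) : Prop :=
  P.im f = S ∧ ∀ (W' : C) (f' : W' ⟶ X), P.im f' ≤ S → ∃! g : W' ⟶ W, g ≫ f = f'

/-- `g` is a quotient of the (normal) cluster `S`. -/
def IsQuotient {X Y : C} (S : P.Cluster X) (g : X ⟶ Y) : Prop :=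
  P.ker g = S ∧ ∀ (Y' : C) (g' : X ⟶ Y'), S ≤ P.ker g' → ∃! h : Y ⟶ Y', g ≫ h = g'

/-! ### Noetherian forms -/

def AxiomN1 : Prop :=
  ∀ {X Y : C} (f : X ⟶ Y),
    (∀ S : P.Cluster X, P.inverse f (P.direct f S) = S ⊔ P.ker f) ∧
    (∀ T : P.Cluster Y, P.direct f (P.inverse f T) = T ⊓ P.im f)

/-- Every morphism is a quotient of its kernel followed by an embedding of its image. -/
def AxiomN2 : Prop :=
  ∀ {X Y : C} (f : X ⟶ Y), ∃ (Z : C) (e : X ⟶ Z) (m : Z ⟶ Y),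
    P.IsQuotient (P.ker f) e ∧ P.IsEmbedding (P.im f) m ∧ e ≫ m = f

def AxiomN3 : Prop :=
  ∀ {X : C} (S T : P.Cluster X),
    (P.IsNormalCluster S → P.IsNormalCluster T → P.IsNormalCluster (S ⊔ T)) ∧
    (P.IsConormalCluster S → P.IsConormalCluster T → P.IsConormalCluster (S ⊓ T))

structure IsNoetherian : Prop where
  n1 : P.AxiomN1
  n2 : P.AxiomN2
  n3 : P.AxiomN3

end Orean

end ClusterSystem

/-! ### Operators -/

/-- An operator between forms, given by its monotone action on clusters. -/
structure Operator (P : ClusterSystem.{w} C) (Q : ClusterSystem.{w'} C) where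
  app : ∀ {X : C}, P.Cluster X → Q.Cluster X
  monotone : ∀ {X Y : C} (f : X ⟶ Y) (A : P.Cluster X) (B : P.Cluster Y),
    P.le f A B → Q.le f (app A) (app B)

namespace Operator

/-- An operator between orean forms is conormal when it preserves images of morphisms. -/
def IsConormal {P : ClusterSystem.{w} C} {Q : ClusterSystem.{w'} C} [P.IsOrean] [Q.IsOrean]
    (τ : Operator P Q) : Prop :=
  ∀ {X Y : C} (f : X ⟶ Y), τ.app (P.im f) = Q.im f

/-- An operator between orean forms is normal when it preserves kernels of morphisms. -/
def IsNormal {P : ClusterSystem.{w} C} {Q : ClusterSystem.{w'} C} [P.IsOrean] [Q.IsOrean]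
    (τ : Operator P Q) : Prop :=
  ∀ {X Y : C} (f : X ⟶ Y), τ.app (P.ker f) = Q.ker f

def IsBinormal {P : ClusterSystem.{w} C} {Q : ClusterSystem.{w'} C} [P.IsOrean] [Q.IsOrean]
    (τ : Operator P Q) : Prop :=
  τ.IsConormal ∧ τ.IsNormal

variable {P : ClusterSystem.{w} C}

def IsIdempotent (κ : Operator P P) : Prop :=
  ∀ {X : C} (S : P.Cluster X), κ.app (κ.app S) = κ.app S

/-- The subform `F_κ` of the clusters `S` with `κ S = S`. -/
def closedForm (κ : Operator P P) : ClusterSystem.{w} C where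
  Cluster X := {S : P.Cluster X // κ.app S = S}
  le f A B := P.le f A.1 B.1
  le_refl S := P.le_refl S.1
  le_comp f g A B D := P.le_comp f g A.1 B.1 D.1
  le_antisymm S T h h' := Subtype.ext (P.le_antisymm S.1 T.1 h h')

/-- The subform inclusion `F_κ → F`. -/
def inclusion (κ : Operator P P) : Operator κ.closedForm P where
  app S := S.1
  monotone _ _ _ h := h

/-- The restriction `F → F_κ` of an idempotent operator `κ`. -/
def projection (κ : Operator P P) (hκ : κ.IsIdempotent) : Operator P κ.closedForm where
  app S := ⟨κ.app S, hκ S⟩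
  monotone := κ.monotone

end Operator

/-! ### Decompositions -/

/-- A conormal orean form and a normal orean form with a conormal operator from the first to the
second and a normal operator from the second to the first. -/
structure IsSemiexactPair (P : ClusterSystem.{w} C) (Q : ClusterSystem.{w'} C)
    [P.IsOrean] [Q.IsOrean] : Prop where
  conormal : P.IsConormal
  normal : Q.IsNormal
  exists_conormal_operator : ∃ α : Operator P Q, α.IsConormal
  exists_normal_operator : ∃ β : Operator Q P, β.IsNormal

/-- The six binary terms in the theory of bounded lattices (up to equality in the theory). -/
inductive LatticeTerm
  | top | bot | fst | snd | sup | inf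

def LatticeTerm.eval {L : Type w} [Lattice L] [BoundedOrder L] : LatticeTerm → L → L → L
  | top, _, _ => ⊤
  | bot, _, _ => ⊥
  | fst, x, _ => x
  | snd, _, y => y
  | sup, x, y => x ⊔ y
  | inf, x, y => x ⊓ y

variable (P : ClusterSystem.{w} C) [P.IsOrean]

/-- `t` is a decomposing term for the pair `(κs, κe)`. -/
def IsDecomposingTerm (κs κe : Operator P P) (t : LatticeTerm) : Prop :=
  ∀ (X : C) (S : P.Cluster X), S = t.eval (κs.app S) (κe.app S)

/-- `(κs, κe)` is a decomposition of the orean form presented by `P`. -/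
structure IsDecomposition (κs κe : Operator P P) : Prop where
  idem_s : κs.IsIdempotent
  idem_e : κe.IsIdempotent
  orean_s : κs.closedForm.IsOrean
  orean_e : κe.closedForm.IsOrean
  conormal_s : κs.closedForm.IsConormal
  normal_e : κe.closedForm.IsNormal
  exists_term : ∃ t : LatticeTerm, IsDecomposingTerm P κs κe t

/-- The decomposition `(κs, κe)` is exact: it is semiexact and the subform inclusions are conormal
and normal, respectively. -/
structure IsExactDecomposition (κs κe : Operator P P) : Prop extends
    IsDecomposition P κs κe where
  projection_s : (κs.projection idem_s).IsBinormal
  projection_e : (κe.projection idem_e).IsBinormal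
  semiexact : IsSemiexactPair κs.closedForm κe.closedForm
  inclusion_s : κs.inclusion.IsConormal
  inclusion_e : κe.inclusion.IsNormal

/-- There is an exact decomposition that is a meet decomposition. -/
def HasExactMeetDecomposition : Prop :=
  ∃ κs κe : Operator P P, IsExactDecomposition P κs κe ∧ IsDecomposingTerm P κs κe .inf

/-- There is an exact decomposition that is both a right decomposition and a meet
decomposition. -/
def HasRightExactMeetDecomposition : Prop :=
  ∃ κs κe : Operator P P, IsExactDecomposition P κs κe ∧
    IsDecomposingTerm P κs κe .snd ∧ IsDecomposingTerm P κs κe .inf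

/-! ### Exact categories and forms of normal subobjects -/

/-- The form of `M`-subobjects, for a class `M` of morphisms: the clusters in `X` are the
subobjects of `X` that are represented by a monomorphism in `M`, and `S ≤_f T` means that the
composite of (a representative of) `S` with `f` factors through `T`. -/
def subobjectForm (M : MorphismProperty C) : ClusterSystem.{max u v} C where
  Cluster X := {S : Subobject X // ∃ (W : C) (m : W ⟶ X) (_ : Mono m), M m ∧ Subobject.mk m = S}
  le f S T := T.1.Factors (S.1.arrow ≫ f)
  le_refl S := by simpa using Subobject.factors_self S.1
  le_comp := by
    intro X Y Z f g A B D h h'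
    rw [← Category.assoc, ← Subobject.factorThru_arrow B.1 _ h, Category.assoc]
    exact Subobject.factors_of_factors_right _ h'
  le_antisymm := by
    intro X S T h h'
    rw [Category.comp_id] at h h'
    exact Subtype.ext (le_antisymm
      (Subobject.le_of_comm (T.1.factorThru _ h) (Subobject.factorThru_arrow _ _ h))
      (Subobject.le_of_comm (S.1.factorThru _ h') (Subobject.factorThru_arrow _ _ h')))

/-- A Puppe–Mitchell exact category (for a category that has a zero object): kernels and cokernels
exist and every morphism is a cokernel followed by a kernel. -/
structure IsPuppeMitchellExact (C : Type u) [Category.{v} C] [HasZeroMorphisms C] : Prop where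
  hasKernels : HasKernels C
  hasCokernels : HasCokernels C
  exists_factorization : ∀ {X Y : C} (f : X ⟶ Y), ∃ (Z : C) (e : X ⟶ Z) (m : Z ⟶ Y),
    Nonempty (NormalEpi e) ∧ Nonempty (NormalMono m) ∧ e ≫ m = f

/-- The form of normal subobjects of a category with zero morphisms. -/
def normalSubobjectForm (C : Type u) [Category.{v} C] [HasZeroMorphisms C] :
    ClusterSystem.{max u v} C :=
  subobjectForm (fun _ _ m => Nonempty (NormalMono m))

/-- `k` is a kernel of `f` relative to the class `N` of null morphisms. -/
def IsNullKernel (N : MorphismProperty C) {K X Y : C} (k : K ⟶ X) (f : X ⟶ Y) : Prop :=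
  N (k ≫ f) ∧ ∀ (W : C) (t : W ⟶ X), N (t ≫ f) → ∃! s : W ⟶ K, s ≫ k = t

/-- `c` is a cokernel of `f` relative to the class `N` of null morphisms. -/
def IsNullCokernel (N : MorphismProperty C) {X Y Q : C} (c : Y ⟶ Q) (f : X ⟶ Y) : Prop :=
  N (f ≫ c) ∧ ∀ (W : C) (t : Y ⟶ W), N (f ≫ t) → ∃! s : Q ⟶ W, c ≫ s = t

/-- `k` is a kernel of some morphism relative to `N`. -/
def nullKernels (N : MorphismProperty C) : MorphismProperty C :=
  fun _ X k => ∃ (Y : C) (f : X ⟶ Y), IsNullKernel N k f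

/-- `c` is a cokernel of some morphism relative to `N`. -/
def nullCokernels (N : MorphismProperty C) : MorphismProperty C :=
  fun Y _ c => ∃ (X : C) (f : X ⟶ Y), IsNullCokernel N c f

/-- `(C, N)` is a Grandis exact category: `N` is a closed ideal of null morphisms admitting kernels
and cokernels, and every morphism is a cokernel followed by a kernel (relative to `N`). -/
structure IsGrandisExact (N : MorphismProperty C) : Prop where
  precomp : ∀ {X Y Z : C} (f : X ⟶ Y) (g : Y ⟶ Z), N g → N (f ≫ g)
  postcomp : ∀ {X Y Z : C} (f : X ⟶ Y) (g : Y ⟶ Z), N f → N (f ≫ g)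
  closed : ∀ {X Y : C} (f : X ⟶ Y), N f →
    ∃ (Z : C) (g : X ⟶ Z) (h : Z ⟶ Y), N (𝟙 Z) ∧ g ≫ h = f
  exists_kernel : ∀ {X Y : C} (f : X ⟶ Y), ∃ (K : C) (k : K ⟶ X), IsNullKernel N k f
  exists_cokernel : ∀ {X Y : C} (f : X ⟶ Y), ∃ (Q : C) (c : Y ⟶ Q), IsNullCokernel N c f
  exists_factorization : ∀ {X Y : C} (f : X ⟶ Y), ∃ (Z : C) (e : X ⟶ Z) (m : Z ⟶ Y),
    nullCokernels N e ∧ nullKernels N m ∧ e ≫ m = f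

end FormTheory

namespace FormTheory

variable {C : Type u} [Category.{v} C]

namespace ClusterSystem

/-! ### Images and kernels in an orean form -/

section Calculus

variable {P : ClusterSystem.{w} C}

/-! The equivalences revolve around (vii), a binormal form satisfying (N2).

Binormality makes the rest of the noetherian axioms automatic. (N3) is immediate. For (N1), factor a
morphism as a quotient `e` followed by an embedding `m`: conormality shows that `m` loses nothing
under direct then inverse image (`IsEmbedding.inverse_direct`), normality shows the dual for `e`
(`IsQuotient.direct_inverse`), and the two combine. A binormal form also has a trivial right exact
meet decomposition, by two identity operators. Conversely, a right decomposition forces every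
cluster to be fixed by `κe`, hence normal. In a normal form, an exact meet decomposition has `κs`
equal to the identity (`IsExactDecomposition.app_eq_self`), so the form coincides with its conormal
part.

The link with exact categories is that, over a pointed category, a normal form with (N2) detects
zero morphisms: `f ≫ g = 0` exactly when `im f ≤ ker g` (`IsNormal.comp_eq_zero_iff`). Embeddings of
kernels are then categorical kernels, quotients of images are categorical cokernels, and (N2)
becomes the exact factorization. Sending a cluster to the subobject given by its embedding
identifies the form with that of normal subobjects. The Grandis version adds nothing, because a zero
object forces the null morphisms to be the zero morphisms (`IsGrandisExact.eq_zeroMorphisms`). -/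

theorem le_of_le_of_le {X Y : C} {f : X ⟶ Y} {S S' : P.Cluster X} {T : P.Cluster Y}
    (h : S ≤ S') (h' : P.le f S' T) : P.le f S T := by
  have := P.le_comp (𝟙 X) f S S' T h h'
  rwa [Category.id_comp] at this

theorem le_of_le_of_le' {X Y : C} {f : X ⟶ Y} {S : P.Cluster X} {T T' : P.Cluster Y}
    (h : P.le f S T) (h' : T ≤ T') : P.le f S T' := by
  have := P.le_comp f (𝟙 Y) S T T' h h'
  rwa [Category.comp_id] at this

variable [hP : P.IsOrean]

theorem direct_le_iff {X Y : C} {f : X ⟶ Y} {S : P.Cluster X} {T : P.Cluster Y} :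
    P.direct f S ≤ T ↔ P.le f S T :=
  ⟨fun h => le_of_le_of_le' (hP.exists_direct f S).choose_spec.1 h,
    fun h => (hP.exists_direct f S).choose_spec.2 h⟩

theorem le_inverse_iff {X Y : C} {f : X ⟶ Y} {S : P.Cluster X} {T : P.Cluster Y} :
    S ≤ P.inverse f T ↔ P.le f S T :=
  ⟨fun h => le_of_le_of_le h (hP.exists_inverse f T).choose_spec.1,
    fun h => (hP.exists_inverse f T).choose_spec.2 h⟩

theorem gc_direct_inverse {X Y : C} (f : X ⟶ Y) :
    GaloisConnection (P.direct f) (P.inverse f) :=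
  fun _ _ => direct_le_iff.trans le_inverse_iff.symm

theorem le_comp_iff {X Y Z : C} {f : X ⟶ Y} {g : Y ⟶ Z} {S : P.Cluster X} {T : P.Cluster Z} :
    P.le (f ≫ g) S T ↔ ∃ B : P.Cluster Y, P.le f S B ∧ P.le g B T :=
  ⟨hP.exists_between f g S T, fun ⟨B, h, h'⟩ => P.le_comp f g S B T h h'⟩

/-- The interpolation axiom `exists_between` supplies an intermediate cluster, and the direct image
along `f` is the least possible one. -/
theorem direct_comp {X Y Z : C} (f : X ⟶ Y) (g : Y ⟶ Z) (S : P.Cluster X) :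
    P.direct (f ≫ g) S = P.direct g (P.direct f S) := by
  refine eq_of_forall_ge_iff fun T => ?_
  rw [direct_le_iff, le_comp_iff, direct_le_iff]
  exact ⟨fun ⟨B, h, h'⟩ => le_of_le_of_le (direct_le_iff.2 h) h',
    fun h => ⟨_, direct_le_iff.1 le_rfl, h⟩⟩

theorem inverse_comp {X Y Z : C} (f : X ⟶ Y) (g : Y ⟶ Z) (T : P.Cluster Z) :
    P.inverse (f ≫ g) T = P.inverse f (P.inverse g T) := by
  refine eq_of_forall_le_iff fun S => ?_
  rw [le_inverse_iff, ← direct_le_iff, direct_comp, (gc_direct_inverse g).le_iff_le,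
    (gc_direct_inverse f).le_iff_le]

theorem direct_id {X : C} (S : P.Cluster X) : P.direct (𝟙 X) S = S :=
  eq_of_forall_ge_iff fun _ => direct_le_iff

theorem inverse_id {X : C} (S : P.Cluster X) : P.inverse (𝟙 X) S = S :=
  eq_of_forall_le_iff fun _ => le_inverse_iff

theorem im_le_iff {X Y : C} {f : X ⟶ Y} {T : P.Cluster Y} : P.im f ≤ T ↔ P.le f ⊤ T :=
  direct_le_iff

theorem le_ker_iff {X Y : C} {f : X ⟶ Y} {S : P.Cluster X} : S ≤ P.ker f ↔ P.le f S ⊥ :=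
  le_inverse_iff

theorem im_id (X : C) : P.im (𝟙 X) = ⊤ := direct_id ⊤

theorem ker_id (X : C) : P.ker (𝟙 X) = ⊥ := inverse_id ⊥

theorem im_comp {X Y Z : C} (f : X ⟶ Y) (g : Y ⟶ Z) :
    P.im (f ≫ g) = P.direct g (P.im f) := direct_comp f g ⊤

theorem ker_comp {X Y Z : C} (f : X ⟶ Y) (g : Y ⟶ Z) :
    P.ker (f ≫ g) = P.inverse f (P.ker g) := inverse_comp f g ⊥

theorem im_comp_le {X Y Z : C} (f : X ⟶ Y) (g : Y ⟶ Z) : P.im (f ≫ g) ≤ P.im g := by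
  rw [im_comp]
  exact (gc_direct_inverse g).monotone_l le_top

theorem ker_le_ker_comp {X Y Z : C} (f : X ⟶ Y) (g : Y ⟶ Z) : P.ker f ≤ P.ker (f ≫ g) := by
  rw [ker_comp]
  exact (gc_direct_inverse f).monotone_u bot_le

theorem im_comp_le_iff {W X Y : C} {m : W ⟶ X} {f : X ⟶ Y} {T : P.Cluster Y} :
    P.im (m ≫ f) ≤ T ↔ P.le f (P.im m) T := by
  rw [im_comp, direct_le_iff]

theorem im_comp_eq_bot_iff {X Y Z : C} {f : X ⟶ Y} {g : Y ⟶ Z} :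
    P.im (f ≫ g) = ⊥ ↔ P.im f ≤ P.ker g := by
  rw [← le_bot_iff, im_comp_le_iff, le_ker_iff]

end Calculus

/-! ### Embeddings and quotients -/

section Factorization

variable {P : ClusterSystem.{w} C} [hP : P.IsOrean]

theorem IsEmbedding.mono {W X : C} {S : P.Cluster X} {m : W ⟶ X} (h : P.IsEmbedding S m) :
    Mono m :=
  ⟨fun _ b hab => (h.2 _ (b ≫ m) ((im_comp_le b m).trans h.1.le)).unique hab rfl⟩

theorem IsQuotient.epi {X Y : C} {S : P.Cluster X} {e : X ⟶ Y} (h : P.IsQuotient S e) :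
    Epi e :=
  ⟨fun _ b hab => (h.2 _ (e ≫ b) (h.1.ge.trans (ker_le_ker_comp e b))).unique hab rfl⟩

theorem IsEmbedding.le_iff {X Y W V : C} {f : X ⟶ Y} {S : P.Cluster X} {T : P.Cluster Y}
    {m : W ⟶ X} {n : V ⟶ Y} (hm : P.IsEmbedding S m) (hn : P.IsEmbedding T n) :
    P.le f S T ↔ ∃ g, g ≫ n = m ≫ f := by
  rw [← hm.1, ← im_comp_le_iff]
  refine ⟨fun h => (hn.2 _ _ h).exists, ?_⟩
  rintro ⟨g, hg⟩
  rw [← hg, ← hn.1]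
  exact im_comp_le g n

theorem AxiomN2.exists_isEmbedding (h : P.AxiomN2) {X : C} {S : P.Cluster X}
    (hS : P.IsConormalCluster S) : ∃ (W : C) (m : W ⟶ X), P.IsEmbedding S m := by
  obtain ⟨_, f, rfl⟩ := hS
  obtain ⟨Z, _, m, _, hm, _⟩ := h f
  exact ⟨Z, m, hm⟩

theorem AxiomN2.exists_isQuotient (h : P.AxiomN2) {X : C} {S : P.Cluster X}
    (hS : P.IsNormalCluster S) : ∃ (Y : C) (e : X ⟶ Y), P.IsQuotient S e := by
  obtain ⟨_, f, rfl⟩ := hS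
  obtain ⟨Z, e, _, he, _, _⟩ := h f
  exact ⟨Z, e, he⟩

/-- The quotient part of the factorization of `e` factors through `e` itself, which splits the
embedding part; a split epimorphism has full image. -/
theorem IsQuotient.im_eq_top (h : P.AxiomN2) {X Y : C} {S : P.Cluster X} {e : X ⟶ Y}
    (he : P.IsQuotient S e) : P.im e = ⊤ := by
  obtain ⟨Z, e', m, he', hm, hem⟩ := h e
  obtain ⟨s, hs, -⟩ := he.2 _ e' (he.1.ge.trans he'.1.ge)
  have := he.epi
  have hsm : s ≫ m = 𝟙 Y := by rw [← cancel_epi e, ← Category.assoc, hs, hem, Category.comp_id]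
  rw [eq_top_iff, ← hm.1, ← im_id Y, ← hsm]
  exact im_comp_le s m

theorem IsEmbedding.ker_eq_bot (h : P.AxiomN2) {W X : C} {S : P.Cluster X} {m : W ⟶ X}
    (hm : P.IsEmbedding S m) : P.ker m = ⊥ := by
  obtain ⟨Z, e, m', he, hm', hem⟩ := h m
  obtain ⟨s, hs, -⟩ := hm.2 _ m' (hm'.1.le.trans hm.1.le)
  have := hm.mono
  have hes : e ≫ s = 𝟙 W := by rw [← cancel_mono m, Category.assoc, hs, hem, Category.id_comp]
  rw [eq_bot_iff, ← he.1, ← ker_id W, ← hes]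
  exact ker_le_ker_comp e s

/-- Conormality turns the comparison of clusters into one of morphisms: `A` is the image of `a`, its
closure is the image of `b`, and both `a ≫ m` and `b ≫ m` factor through the embedding `n` of the
image of `a ≫ m`. Cancelling `m` shows that `a` and `b` factor through the same `d`, and `a` does so
by a morphism with full image. -/
theorem IsEmbedding.inverse_direct (h : P.AxiomN2) (hc : P.IsConormal) {W X : C}
    {S : P.Cluster X} {m : W ⟶ X} (hm : P.IsEmbedding S m) (A : P.Cluster W) :
    P.inverse m (P.direct m A) = A := by
  refine _root_.le_antisymm ?_ ((gc_direct_inverse m).le_u_l A)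
  obtain ⟨V, a, rfl⟩ := hc W A
  obtain ⟨U, b, hb⟩ := hc W (P.inverse m (P.direct m (P.im a)))
  obtain ⟨Z, e, n, he, hn, hen⟩ := h (a ≫ m)
  obtain ⟨d, hd, -⟩ := hm.2 _ n (by rw [hn.1, ← hm.1]; exact im_comp_le a m)
  obtain ⟨c, hcn, -⟩ := hn.2 _ (b ≫ m) (by
    rw [im_comp, im_comp, hb]
    exact (gc_direct_inverse m).l_u_le _)
  have := hm.mono
  have had : e ≫ d = a := by rw [← cancel_mono m, Category.assoc, hd, hen]
  have hbd : c ≫ d = b := by rw [← cancel_mono m, Category.assoc, hd, hcn]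
  rw [← hb, ← hbd, ← had, im_comp e d, he.im_eq_top h]
  exact im_comp_le c d

theorem IsQuotient.direct_inverse (h : P.AxiomN2) (hn : P.IsNormal) {X Y : C}
    {S : P.Cluster X} {e : X ⟶ Y} (he : P.IsQuotient S e) (B : P.Cluster Y) :
    P.direct e (P.inverse e B) = B := by
  refine _root_.le_antisymm ((gc_direct_inverse e).l_u_le B) ?_
  obtain ⟨V, b, rfl⟩ := hn Y B
  obtain ⟨U, a, ha⟩ := hn Y (P.direct e (P.inverse e (P.ker b)))
  obtain ⟨Z, q, m, hq, hm, hqm⟩ := h (e ≫ b)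
  obtain ⟨d, hd, -⟩ := he.2 _ q (by rw [hq.1, ← he.1]; exact ker_le_ker_comp e b)
  obtain ⟨c, hcn, -⟩ := hq.2 _ (e ≫ a) (by
    rw [ker_comp, ker_comp, ha]
    exact (gc_direct_inverse e).le_u_l _)
  have := he.epi
  have hdb : d ≫ m = b := by rw [← cancel_epi e, ← Category.assoc, hd, hqm]
  have hda : d ≫ c = a := by rw [← cancel_epi e, ← Category.assoc, hd, hcn]
  rw [← ha, ← hda, ← hdb, ker_comp d m, hm.ker_eq_bot h]
  exact ker_le_ker_comp d c

/-- A binormal orean form in which morphisms factorize is noetherian. -/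
theorem IsBinormal.axiomN1 (hb : P.IsBinormal) (h : P.AxiomN2) : P.AxiomN1 := by
  intro X Y f
  obtain ⟨Z, e, m, he, hm, rfl⟩ := h f
  refine ⟨fun S => _root_.le_antisymm ?_ ?_, fun T => _root_.le_antisymm ?_ ?_⟩
  -- Presenting the join as the kernel of some `g` lets `g` descend along `e`, so the join is an
  -- inverse image along `e`.
  · obtain ⟨U, g, hg⟩ := hb.1 X (S ⊔ P.ker (e ≫ m))
    obtain ⟨g', rfl, -⟩ := he.2 _ g (by rw [hg]; exact le_sup_right)
    rw [direct_comp, inverse_comp, hm.inverse_direct h hb.2, ← hg, ker_comp]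
    refine (gc_direct_inverse e).monotone_u ((gc_direct_inverse e).l_le ?_)
    rw [← ker_comp, hg]
    exact le_sup_left
  · exact sup_le ((gc_direct_inverse _).le_u_l S) ((gc_direct_inverse _).monotone_u bot_le)
  · exact le_inf ((gc_direct_inverse _).l_u_le T) ((gc_direct_inverse _).monotone_l le_top)
  · obtain ⟨U, g, hg⟩ := hb.2 Y (T ⊓ P.im (e ≫ m))
    obtain ⟨g', rfl, -⟩ := hm.2 _ g (by rw [hg]; exact inf_le_right)
    rw [direct_comp, inverse_comp, he.direct_inverse h hb.1, ← hg, im_comp]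
    refine (gc_direct_inverse m).monotone_l ((gc_direct_inverse m).le_u ?_)
    rw [← im_comp, hg]
    exact inf_le_left

theorem IsBinormal.isNoetherian (hb : P.IsBinormal) (h : P.AxiomN2) : P.IsNoetherian :=
  ⟨hb.axiomN1 h, h, fun _ _ => ⟨fun _ _ => hb.1 _ _, fun _ _ => hb.2 _ _⟩⟩

end Factorization

/-! ### Orean forms over pointed categories -/

section Pointed

variable {P : ClusterSystem.{w} C} [hP : P.IsOrean] [HasZeroMorphisms C] [HasZeroObject C]

open scoped ZeroObject

/-- A morphism out of the zero object, followed by the map back to it, is the identity, whose kernel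
is the bottom. -/
theorem IsNormal.top_eq_bot_zero (hn : P.IsNormal) : (⊤ : P.Cluster (0 : C)) = ⊥ := by
  obtain ⟨Y, g, hg⟩ := hn 0 ⊤
  rw [eq_bot_iff, ← hg, ← ker_id, ← (isZero_zero C).eq_of_src (g ≫ 0) (𝟙 _)]
  exact ker_le_ker_comp g 0

theorem IsNormal.im_from_zero (hn : P.IsNormal) {X : C} (f : (0 : C) ⟶ X) : P.im f = ⊥ := by
  rw [im, hn.top_eq_bot_zero]
  exact (gc_direct_inverse f).l_bot

theorem IsNormal.im_eq_bot_iff (hn : P.IsNormal) (h : P.AxiomN2) {X Y : C} {f : X ⟶ Y} :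
    P.im f = ⊥ ↔ f = 0 := by
  constructor
  · intro hf
    -- An epimorphism out of the zero object forces `m = 0`, and anything with bottom image factors
    -- through `m`.
    obtain ⟨Z, e, m, he, hm, -⟩ := h (0 : (0 : C) ⟶ Y)
    have := he.epi
    have hm0 : m = 0 := by
      rw [← cancel_epi e]
      exact (isZero_zero C).eq_of_src _ _
    obtain ⟨g, rfl, -⟩ := hm.2 _ f (hf.le.trans bot_le)
    rw [hm0, comp_zero]
  · rintro rfl
    rw [eq_bot_iff, ← hn.im_from_zero (0 : (0 : C) ⟶ Y), ← zero_comp (f := (0 : (0 : C) ⟶ Y))]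
    exact im_comp_le _ _

theorem IsNormal.comp_eq_zero_iff (hn : P.IsNormal) (h : P.AxiomN2) {X Y Z : C} {f : X ⟶ Y}
    {g : Y ⟶ Z} : f ≫ g = 0 ↔ P.im f ≤ P.ker g := by
  rw [← hn.im_eq_bot_iff h, im_comp_eq_bot_iff]

end Pointed

end ClusterSystem

/-! ### Grandis exactness relative to the zero morphisms -/

section Grandis

theorem IsNullKernel.mono {N : MorphismProperty C}
    (hN : ∀ {X Y Z : C} (f : X ⟶ Y) (g : Y ⟶ Z), N g → N (f ≫ g)) {K X Y : C} {k : K ⟶ X}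
    {f : X ⟶ Y} (h : IsNullKernel N k f) : Mono k :=
  ⟨fun _ b hab => (h.2 _ (b ≫ k) (by rw [Category.assoc]; exact hN _ _ h.1)).unique hab rfl⟩

theorem IsNullCokernel.epi {N : MorphismProperty C}
    (hN : ∀ {X Y Z : C} (f : X ⟶ Y) (g : Y ⟶ Z), N f → N (f ≫ g)) {X Y Q : C} {c : Y ⟶ Q}
    {f : X ⟶ Y} (h : IsNullCokernel N c f) : Epi c :=
  ⟨fun _ b hab => (h.2 _ (c ≫ b) (by rw [← Category.assoc]; exact hN _ _ h.1)).unique hab rfl⟩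

variable [HasZeroMorphisms C]

/-- The class of zero morphisms. -/
def zeroMorphisms (C : Type u) [Category.{v} C] [HasZeroMorphisms C] : MorphismProperty C :=
  fun _ _ f => f = 0

theorem zeroMorphisms_precomp {X Y Z : C} (f : X ⟶ Y) (g : Y ⟶ Z) (h : zeroMorphisms C g) :
    zeroMorphisms C (f ≫ g) := by
  rw [show g = 0 from h]
  exact comp_zero

theorem zeroMorphisms_postcomp {X Y Z : C} (f : X ⟶ Y) (g : Y ⟶ Z) (h : zeroMorphisms C f) :
    zeroMorphisms C (f ≫ g) := by
  rw [show f = 0 from h]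
  exact zero_comp

theorem isNullKernel_zeroMorphisms_iff {K X Y : C} {k : K ⟶ X} {f : X ⟶ Y} :
    IsNullKernel (zeroMorphisms C) k f ↔
      ∃ h : k ≫ f = 0, Nonempty (IsLimit (KernelFork.ofι k h)) := by
  constructor
  · rintro ⟨h, h'⟩
    exact ⟨h, ⟨Fork.IsLimit.ofExistsUnique fun s => h' _ s.ι (KernelFork.condition s)⟩⟩
  · rintro ⟨h, ⟨hl⟩⟩
    exact ⟨h, fun W t ht => Fork.IsLimit.existsUnique hl t (by rw [comp_zero]; exact ht)⟩

theorem isNullCokernel_zeroMorphisms_iff {X Y Q : C} {c : Y ⟶ Q} {f : X ⟶ Y} :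
    IsNullCokernel (zeroMorphisms C) c f ↔
      ∃ h : f ≫ c = 0, Nonempty (IsColimit (CokernelCofork.ofπ c h)) := by
  constructor
  · rintro ⟨h, h'⟩
    exact ⟨h, ⟨Cofork.IsColimit.ofExistsUnique fun s => h' _ s.π (CokernelCofork.condition s)⟩⟩
  · rintro ⟨h, ⟨hl⟩⟩
    exact ⟨h, fun W t ht => Cofork.IsColimit.existsUnique hl t (by rw [zero_comp]; exact ht)⟩

theorem nullKernels_zeroMorphisms_iff {X Y : C} {m : X ⟶ Y} :
    nullKernels (zeroMorphisms C) m ↔ Nonempty (NormalMono m) := by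
  simp only [nullKernels, isNullKernel_zeroMorphisms_iff]
  exact ⟨fun ⟨Z, g, w, ⟨l⟩⟩ => ⟨⟨Z, g, w, l⟩⟩, fun ⟨n⟩ => ⟨n.Z, n.g, n.w, ⟨n.isLimit⟩⟩⟩

theorem nullCokernels_zeroMorphisms_iff {X Y : C} {e : X ⟶ Y} :
    nullCokernels (zeroMorphisms C) e ↔ Nonempty (NormalEpi e) := by
  simp only [nullCokernels, isNullCokernel_zeroMorphisms_iff]
  exact ⟨fun ⟨Z, g, w, ⟨l⟩⟩ => ⟨⟨Z, g, w, l⟩⟩, fun ⟨n⟩ => ⟨n.W, n.g, n.w, ⟨n.isColimit⟩⟩⟩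

theorem subobjectForm_nullKernels_zeroMorphisms :
    subobjectForm (nullKernels (zeroMorphisms C)) = normalSubobjectForm C := by
  refine congrArg subobjectForm ?_
  ext X Y m
  exact nullKernels_zeroMorphisms_iff

variable [HasZeroObject C]

open scoped ZeroObject

theorem isGrandisExact_zeroMorphisms_iff :
    IsGrandisExact (zeroMorphisms C) ↔ IsPuppeMitchellExact C := by
  constructor
  · intro h
    refine ⟨⟨fun {X Y} f => ?_⟩, ⟨fun {X Y} f => ?_⟩, fun f => ?_⟩
    · obtain ⟨K, k, hk⟩ := h.exists_kernel f
      obtain ⟨_, ⟨l⟩⟩ := isNullKernel_zeroMorphisms_iff.1 hk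
      exact ⟨⟨_, l⟩⟩
    · obtain ⟨Q, c, hc⟩ := h.exists_cokernel f
      obtain ⟨_, ⟨l⟩⟩ := isNullCokernel_zeroMorphisms_iff.1 hc
      exact ⟨⟨_, l⟩⟩
    · obtain ⟨Z, e, m, he, hm, hem⟩ := h.exists_factorization f
      exact ⟨Z, e, m, nullCokernels_zeroMorphisms_iff.1 he, nullKernels_zeroMorphisms_iff.1 hm,
        hem⟩
  · intro h
    have := h.hasKernels
    have := h.hasCokernels
    refine ⟨zeroMorphisms_precomp, zeroMorphisms_postcomp, fun f hf => ?_, fun f => ?_,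
      fun f => ?_, fun f => ?_⟩
    · exact ⟨0, 0, 0, (isZero_zero C).eq_of_src _ _, by rw [show f = 0 from hf, comp_zero]⟩
    · exact ⟨_, kernel.ι f, isNullKernel_zeroMorphisms_iff.2
        ⟨kernel.condition f, ⟨kernelIsKernel f⟩⟩⟩
    · exact ⟨_, cokernel.π f, isNullCokernel_zeroMorphisms_iff.2
        ⟨cokernel.condition f, ⟨cokernelIsCokernel f⟩⟩⟩
    · obtain ⟨Z, e, m, he, hm, hem⟩ := h.exists_factorization f
      exact ⟨Z, e, m, nullCokernels_zeroMorphisms_iff.2 he, nullKernels_zeroMorphisms_iff.2 hm,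
        hem⟩

/-- If the identity of `Z` is null then so is every morphism out of `Z`, so the identity factors
through any kernel into `Z`. The factorization of `0 ⟶ Z` provides such a kernel that is zero. -/
theorem IsGrandisExact.isZero_of_null {N : MorphismProperty C} (h : IsGrandisExact N) {Z : C}
    (hZ : N (𝟙 Z)) : IsZero Z := by
  obtain ⟨W, e, m, ⟨_, _, he⟩, ⟨_, f, hm⟩, -⟩ := h.exists_factorization (0 : (0 : C) ⟶ Z)
  have := he.epi h.postcomp
  have hm0 : m = 0 := by
    rw [← cancel_epi e]
    exact (isZero_zero C).eq_of_src _ _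
  obtain ⟨s, hs, -⟩ := hm.2 Z (𝟙 Z) (h.postcomp _ _ hZ)
  rw [IsZero.iff_id_eq_zero, ← hs, hm0, comp_zero]

/-- The null morphisms of a pointed Grandis exact category are the zero morphisms. -/
theorem IsGrandisExact.eq_zeroMorphisms {N : MorphismProperty C} (h : IsGrandisExact N) :
    N = zeroMorphisms C := by
  ext X Y f
  constructor
  · intro hf
    obtain ⟨Z, g, k, hZ, rfl⟩ := h.closed f hf
    rw [(h.isZero_of_null hZ).eq_of_tgt g 0]
    exact zero_comp
  · intro hf
    obtain ⟨K, k, hk⟩ := h.exists_kernel (𝟙 (0 : C))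
    have h0 : f = ((0 : X ⟶ K) ≫ k ≫ 𝟙 0) ≫ (0 : (0 : C) ⟶ Y) := by
      rw [comp_zero]
      exact hf
    rw [h0]
    exact h.postcomp _ _ (h.precomp _ _ hk.1)

theorem isPuppeMitchellExact_iff_exists_isGrandisExact :
    IsPuppeMitchellExact C ↔ ∃ N : MorphismProperty C, IsGrandisExact N :=
  ⟨fun h => ⟨_, isGrandisExact_zeroMorphisms_iff.2 h⟩, fun ⟨_, h⟩ =>
    isGrandisExact_zeroMorphisms_iff.1 (h.eq_zeroMorphisms ▸ h)⟩

theorem isPuppeMitchellExact_and_iso_iff (P : ClusterSystem.{w} C) :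
    (IsPuppeMitchellExact C ∧ Nonempty (P.Iso (normalSubobjectForm C))) ↔
      ∃ N : MorphismProperty C, IsGrandisExact N ∧
        Nonempty (P.Iso (subobjectForm (nullKernels N))) := by
  rw [← isGrandisExact_zeroMorphisms_iff, ← subobjectForm_nullKernels_zeroMorphisms]
  refine ⟨fun h => ⟨_, h⟩, ?_⟩
  rintro ⟨N, hN, i⟩
  obtain rfl := hN.eq_zeroMorphisms
  exact ⟨hN, i⟩

end Grandis

/-! ### Binormal forms with factorizations are forms of normal subobjects -/

section NormalSubobjects

theorem factors_arrow_comp_iff {X Y W V : C} (m : W ⟶ X) (n : V ⟶ Y) [Mono m] [Mono n]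
    (f : X ⟶ Y) :
    (Subobject.mk n).Factors ((Subobject.mk m).arrow ≫ f) ↔ ∃ g, g ≫ n = m ≫ f := by
  rw [Subobject.mk_factors_iff]
  constructor
  · rintro ⟨g, hg⟩
    obtain ⟨g, hg⟩ : ∃ g : (Subobject.mk m : C) ⟶ V, g ≫ n = (Subobject.mk m).arrow ≫ f :=
      ⟨g, hg⟩
    refine ⟨(Subobject.underlyingIso m).inv ≫ g, ?_⟩
    rw [Category.assoc, hg, ← Category.assoc, Subobject.underlyingIso_arrow]
  · rintro ⟨g, hg⟩
    refine ⟨(Subobject.underlyingIso m).hom ≫ g, ?_⟩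
    change (_ ≫ g) ≫ n = _
    rw [Category.assoc, hg, ← Category.assoc, Subobject.underlyingIso_hom_comp_eq_mk]

variable {P : ClusterSystem.{w} C}

/-- The monomorphisms that represent the clusters of a form of subobjects. -/
theorem ClusterSystem.Iso.exists_representation {M : MorphismProperty C}
    (hM : ∀ {W X : C} (m : W ⟶ X), M m → Mono m) (i : P.Iso (subobjectForm M)) :
    ∃ R : ∀ {W X : C}, (W ⟶ X) → P.Cluster X → Prop,
      (∀ {X : C} (S : P.Cluster X), ∃ (W : C) (m : W ⟶ X), M m ∧ R m S) ∧
      (∀ {W X : C} (m : W ⟶ X), M m → ∃ S, R m S) ∧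
      ∀ {X Y W V : C} (f : X ⟶ Y) (S : P.Cluster X) (T : P.Cluster Y) (m : W ⟶ X) (n : V ⟶ Y),
        R m S → R n T → (P.le f S T ↔ ∃ g, g ≫ n = m ≫ f) := by
  refine ⟨fun {W X} m S => ∃ _ : Mono m, Subobject.mk m = (i.equiv X S).1, fun {X} S => ?_,
    fun {W X} m hm => ?_, ?_⟩
  · obtain ⟨W, m, hm, hMm, h⟩ := (i.equiv X S).2
    exact ⟨W, m, hMm, hm, h⟩
  · have := hM m hm
    obtain ⟨S, hS⟩ := (i.equiv X).surjective ⟨Subobject.mk m, W, m, this, hm, rfl⟩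
    exact ⟨S, this, (congrArg Subtype.val hS).symm⟩
  · rintro X Y W V f S T m n ⟨_, hm⟩ ⟨_, hn⟩
    rw [i.le_iff, ← factors_arrow_comp_iff m n f, hm, hn]
    rfl

variable [hP : P.IsOrean] [HasZeroMorphisms C] [HasZeroObject C]

open scoped ZeroObject
open ClusterSystem

theorem isBinormal_and_axiomN2_of_iso (h : IsGrandisExact (zeroMorphisms C))
    (i : P.Iso (subobjectForm (nullKernels (zeroMorphisms C)))) :
    P.IsBinormal ∧ P.AxiomN2 := by
  have hmono : ∀ {W X : C} (m : W ⟶ X), nullKernels (zeroMorphisms C) m → Mono m :=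
    fun m ⟨_, _, hm⟩ => hm.mono h.precomp
  obtain ⟨R, hR, hR', hle⟩ := i.exists_representation hmono
  -- Identities are kernels of maps to the zero object and maps from it are kernels of identities;
  -- they represent the top and bottom clusters.
  have hid : ∀ X : C, nullKernels (zeroMorphisms C) (𝟙 X) := fun X =>
    ⟨0, 0, comp_zero, fun W t _ => ⟨t, Category.comp_id t, fun y hy => by
      rw [← hy, Category.comp_id]⟩⟩
  have hzero : ∀ X : C, nullKernels (zeroMorphisms C) (0 : 0 ⟶ X) := fun X =>
    ⟨X, 𝟙 X, zero_comp, fun W t ht => ⟨0,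
      zero_comp.trans (Eq.symm ((Category.comp_id t).symm.trans ht)), fun y _ => (isZero_zero C).eq_of_tgt _ _⟩⟩
  have htop : ∀ X : C, R (𝟙 X) (⊤ : P.Cluster X) := fun X => by
    obtain ⟨T, hT⟩ := hR' (𝟙 X) (hid X)
    obtain ⟨W, m, -, hm⟩ := hR (⊤ : P.Cluster X)
    have : (⊤ : P.Cluster X) ≤ T := (hle (𝟙 X) ⊤ T m (𝟙 X) hm hT).2 ⟨m, rfl⟩
    rwa [← top_le_iff.1 this]
  have hbot : ∀ X : C, R (0 : 0 ⟶ X) (⊥ : P.Cluster X) := fun X => by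
    obtain ⟨T, hT⟩ := hR' (0 : 0 ⟶ X) (hzero X)
    obtain ⟨W, m, -, hm⟩ := hR (⊥ : P.Cluster X)
    have : T ≤ (⊥ : P.Cluster X) :=
      (hle (𝟙 X) T ⊥ 0 m hT hm).2 ⟨0, by rw [zero_comp, zero_comp]⟩
    rwa [← le_bot_iff.1 this]
  have him : ∀ {X Y W : C} (f : X ⟶ Y) (T : P.Cluster Y) (n : W ⟶ Y), R n T →
      (P.im f ≤ T ↔ ∃ g, g ≫ n = f) := fun f T n hn => by
    rw [im_le_iff, hle f ⊤ T _ n (htop _) hn, Category.id_comp]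
  have hker : ∀ {X Y W : C} (f : X ⟶ Y) (S : P.Cluster X) (m : W ⟶ X), R m S →
      (S ≤ P.ker f ↔ m ≫ f = 0) := fun f S m hm => by
    rw [le_ker_iff, hle f S ⊥ m _ hm (hbot _)]
    exact ⟨fun ⟨g, hg⟩ => by rw [← hg, comp_zero], fun hg => ⟨0, by rw [hg, comp_zero]⟩⟩
  have hkernel : ∀ {X Y K : C} {f : X ⟶ Y} {k : K ⟶ X} {S : P.Cluster X},
      IsNullKernel (zeroMorphisms C) k f → R k S → P.ker f = S := fun {X Y K f k S} hk hS => by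
    refine _root_.le_antisymm ?_ ((hker f S k hS).2 hk.1)
    obtain ⟨W, m, -, hm⟩ := hR (P.ker f)
    obtain ⟨s, hs, -⟩ := hk.2 _ m ((hker f _ m hm).1 le_rfl)
    exact (hle (𝟙 X) _ S m k hm hS).2 ⟨s, by rw [hs, Category.comp_id]⟩
  have hself : ∀ {X W : C} {S : P.Cluster X} {m : W ⟶ X}, R m S → P.im m = S :=
      fun {X W S m} hm => by
    refine _root_.le_antisymm ((him m S m hm).2 ⟨𝟙 _, Category.id_comp m⟩) ?_
    obtain ⟨V, n, -, hn⟩ := hR (P.im m)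
    obtain ⟨g, hg⟩ := (him m _ n hn).1 le_rfl
    exact (hle (𝟙 X) S _ m n hm hn).2 ⟨g, by rw [hg, Category.comp_id]⟩
  refine ⟨⟨fun X S => ?_, fun X S => ?_⟩, fun {X Y} f => ?_⟩
  · obtain ⟨W, m, ⟨Y, g, hg⟩, hm⟩ := hR S
    exact ⟨Y, g, hkernel hg hm⟩
  · obtain ⟨W, m, -, hm⟩ := hR S
    exact ⟨W, m, hself hm⟩
  · obtain ⟨Z, e, m, ⟨V, a, ha⟩, ⟨U, b, hb⟩, rfl⟩ := h.exists_factorization f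
    have := hmono m ⟨U, b, hb⟩
    have := ha.epi h.postcomp
    obtain ⟨T, hT⟩ := hR' m ⟨U, b, hb⟩
    have hmT : P.im m = T := hself hT
    have hfT : P.im (e ≫ m) = T := by
      refine _root_.le_antisymm ((him _ T m hT).2 ⟨e, rfl⟩) ?_
      obtain ⟨W, n, ⟨D, d, hd⟩, hn⟩ := hR (P.im (e ≫ m))
      obtain ⟨g, hg⟩ := (him _ _ n hn).1 le_rfl
      -- Since `e ≫ m` factors through the kernel `n` of `d` and `e` is epi, `m` is killed by `d`
      -- and so factors through `n` as well.
      have hmd : m ≫ d = 0 := by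
        rw [← cancel_epi e, ← Category.assoc, ← hg, Category.assoc,
          show n ≫ d = 0 from hd.1, comp_zero, comp_zero]
      obtain ⟨s, hs, -⟩ := hd.2 _ m hmd
      exact (hle (𝟙 Y) T _ m n hT hn).2 ⟨s, by rw [hs, Category.comp_id]⟩
    obtain ⟨K, k, hk⟩ := h.exists_kernel (e ≫ m)
    obtain ⟨S, hS⟩ := hR' k ⟨_, _, hk⟩
    have hkS := hkernel hk hS
    have hke : k ≫ e = 0 := by
      rw [← cancel_mono m, Category.assoc, zero_comp]
      exact hk.1
    refine ⟨Z, e, m, ⟨_root_.le_antisymm (ker_le_ker_comp e m) ?_, fun Y' g' hg' => ?_⟩,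
      ⟨hmT.trans hfT.symm, fun W' f' hf' => ?_⟩, rfl⟩
    · rw [hkS]
      exact (hker e S k hS).2 hke
    · rw [hkS, hker g' S k hS] at hg'
      -- The morphism `a` of which `e` is a cokernel factors through the kernel of `e ≫ m`, which
      -- `g'` kills.
      have hag : a ≫ g' = 0 := by
        obtain ⟨s, hs, -⟩ := hk.2 _ a (by
          rw [← Category.assoc, show a ≫ e = 0 from ha.1]
          exact zero_comp)
        rw [← hs, Category.assoc, hg', comp_zero]
      exact ha.2 _ g' hag
    · rw [hfT, him f' T m hT] at hf'
      obtain ⟨g, hg⟩ := hf'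
      exact ⟨g, hg, fun y hy => by rw [← cancel_mono m, hg, hy]⟩

theorem ClusterSystem.IsEmbedding.isNullKernel (hn : P.IsNormal) (h : P.AxiomN2) {K X Y : C}
    {k : K ⟶ X} {f : X ⟶ Y} (hk : P.IsEmbedding (P.ker f) k) :
    IsNullKernel (zeroMorphisms C) k f :=
  ⟨(hn.comp_eq_zero_iff h).2 hk.1.le, fun _ t ht => hk.2 _ t ((hn.comp_eq_zero_iff h).1 ht)⟩

theorem ClusterSystem.IsQuotient.isNullCokernel (hn : P.IsNormal) (h : P.AxiomN2) {X Y Q : C}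
    {c : Y ⟶ Q} {f : X ⟶ Y} (hc : P.IsQuotient (P.im f) c) :
    IsNullCokernel (zeroMorphisms C) c f :=
  ⟨(hn.comp_eq_zero_iff h).2 hc.1.ge, fun _ t ht => hc.2 _ t ((hn.comp_eq_zero_iff h).1 ht)⟩

theorem ClusterSystem.IsBinormal.isGrandisExact (hb : P.IsBinormal) (h : P.AxiomN2) :
    IsGrandisExact (zeroMorphisms C) := by
  refine ⟨zeroMorphisms_precomp, zeroMorphisms_postcomp, fun f hf => ?_, fun f => ?_,
    fun f => ?_, fun f => ?_⟩
  · exact ⟨0, 0, 0, (isZero_zero C).eq_of_src _ _, by rw [show f = 0 from hf, comp_zero]⟩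
  · obtain ⟨K, k, hk⟩ := h.exists_isEmbedding (hb.2 _ (P.ker f))
    exact ⟨K, k, hk.isNullKernel hb.1 h⟩
  · obtain ⟨Q, c, hc⟩ := h.exists_isQuotient (hb.1 _ (P.im f))
    exact ⟨Q, c, hc.isNullCokernel hb.1 h⟩
  · obtain ⟨Z, e, m, he, hm, hem⟩ := h f
    obtain ⟨W, a, ha⟩ := hb.2 _ (P.ker f)
    obtain ⟨V, b, hb'⟩ := hb.1 _ (P.im f)
    rw [← ha] at he
    rw [← hb'] at hm
    exact ⟨Z, e, m, ⟨W, a, he.isNullCokernel hb.1 h⟩, ⟨V, b, hm.isNullKernel hb.1 h⟩, hem⟩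

theorem ClusterSystem.IsBinormal.nonempty_iso (hb : P.IsBinormal) (h : P.AxiomN2) :
    Nonempty (P.Iso (subobjectForm (nullKernels (zeroMorphisms C)))) := by
  choose W m hm using fun (X : C) (S : P.Cluster X) => h.exists_isEmbedding (hb.2 X S)
  have hmono : ∀ (X : C) (S : P.Cluster X), Mono (m X S) := fun X S => (hm X S).mono
  have hnull : ∀ (X : C) (S : P.Cluster X), nullKernels (zeroMorphisms C) (m X S) := by
    intro X S
    obtain ⟨Y, g, rfl⟩ := hb.1 X S
    exact ⟨Y, g, (hm X _).isNullKernel hb.1 h⟩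
  let φ (X : C) (S : P.Cluster X) :
      (subobjectForm (nullKernels (zeroMorphisms C))).Cluster X :=
    ⟨Subobject.mk (m X S), W X S, m X S, hmono X S, hnull X S, rfl⟩
  have hle : ∀ {X Y : C} (f : X ⟶ Y) (S : P.Cluster X) (T : P.Cluster Y),
      P.le f S T ↔ (subobjectForm (nullKernels (zeroMorphisms C))).le f (φ X S) (φ Y T) :=
    fun f S T => ((hm _ S).le_iff (hm _ T)).trans (factors_arrow_comp_iff _ _ f).symm
  have hbij : ∀ X : C, Function.Bijective (φ X) := by
    refine fun X => ⟨fun S T hST => ?_, ?_⟩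
    · refine P.le_antisymm S T ((hle _ S T).2 ?_) ((hle _ T S).2 ?_) <;> rw [hST] <;>
        exact ClusterSystem.le_refl _ _
    · rintro ⟨_, V, n, hn, ⟨Y, g, hg⟩, rfl⟩
      -- A normal monomorphism `n` and the chosen embedding of `ker g` are both kernels of `g`, so
      -- they represent the same subobject.
      refine ⟨P.ker g, Subtype.ext ?_⟩
      have hk := (hm X (P.ker g)).isNullKernel hb.1 h
      obtain ⟨s, hs, -⟩ := hk.2 _ n hg.1
      obtain ⟨t, ht, -⟩ := hg.2 _ (m X (P.ker g)) hk.1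
      exact _root_.le_antisymm (Subobject.mk_le_mk_of_comm t ht) (Subobject.mk_le_mk_of_comm s hs)
  exact ⟨⟨fun X => Equiv.ofBijective (φ X) (hbij X), hle⟩⟩

end NormalSubobjects

/-! ### Decompositions -/

section Decomposition

open ClusterSystem

/-- The identity operator. -/
def Operator.id (P : ClusterSystem.{w} C) : Operator P P where
  app S := S
  monotone _ _ _ h := h

variable {P : ClusterSystem.{w} C} [hP : P.IsOrean]

theorem Operator.isOrean_closedForm_id : (Operator.id P).closedForm.IsOrean where
  exists_top X := ⟨⟨⊤, rfl⟩, fun S => le_top (a := S.1)⟩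
  exists_bot X := ⟨⟨⊥, rfl⟩, fun S => bot_le (a := S.1)⟩
  exists_sup S T := ⟨⟨S.1 ⊔ T.1, rfl⟩, by
    rintro V (rfl | rfl)
    exacts [le_sup_left (a := V.1), le_sup_right (b := V.1)],
    fun V hV => sup_le (a := S.1) (b := T.1) (c := V.1) (hV (Or.inl rfl)) (hV (Or.inr rfl))⟩
  exists_inf S T := ⟨⟨S.1 ⊓ T.1, rfl⟩, by
    rintro V (rfl | rfl)
    exacts [inf_le_left (a := V.1), inf_le_right (b := V.1)],
    fun V hV => le_inf (α := P.Cluster _) (hV (Or.inl rfl)) (hV (Or.inr rfl))⟩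
  exists_between f g A D h := by
    obtain ⟨B, h⟩ := hP.exists_between f g A.1 D.1 h
    exact ⟨⟨B, rfl⟩, h⟩
  exists_direct f S := by
    obtain ⟨T, h, h'⟩ := hP.exists_direct f S.1
    exact ⟨⟨T, rfl⟩, h, fun V hV => h' (a := V.1) hV⟩
  exists_inverse f T := by
    obtain ⟨S, h, h'⟩ := hP.exists_inverse f T.1
    exact ⟨⟨S, rfl⟩, h, fun V hV => h' (a := V.1) hV⟩

section

variable [(Operator.id P).closedForm.IsOrean]

/-- The top cluster of the closed form comes from its own orean structure, by choice, so the two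
images are compared through their universal properties. -/
theorem Operator.closedForm_id_im {X Y : C} (f : X ⟶ Y) :
    ((Operator.id P).closedForm.im f).1 = P.im f := by
  refine _root_.le_antisymm ?_ ?_
  · have h : P.le f ⊤ (P.im f) := im_le_iff.1 le_rfl
    have : (Operator.id P).closedForm.im f ≤ ⟨P.im f, rfl⟩ :=
      im_le_iff.2 (le_of_le_of_le (P := P) (S' := ⊤) le_top h)
    exact this
  · have h : (Operator.id P).closedForm.le f ⟨⊤, rfl⟩ ((Operator.id P).closedForm.im f) :=
      le_of_le_of_le le_top (im_le_iff.1 le_rfl)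
    exact im_le_iff.2 h

theorem Operator.closedForm_id_ker {X Y : C} (f : X ⟶ Y) :
    ((Operator.id P).closedForm.ker f).1 = P.ker f := by
  refine _root_.le_antisymm ?_ ?_
  · have h : (Operator.id P).closedForm.le f ((Operator.id P).closedForm.ker f) ⟨⊥, rfl⟩ :=
      le_of_le_of_le' (le_ker_iff.1 le_rfl) bot_le
    exact le_ker_iff.2 h
  · have h : P.le f (P.ker f) ⊥ := le_ker_iff.1 le_rfl
    have : ⟨P.ker f, rfl⟩ ≤ (Operator.id P).closedForm.ker f :=
      le_ker_iff.2 (le_of_le_of_le' (P := P) (T := ⊥) h bot_le)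
    exact this

end

/-- The identity operators form an exact decomposition of a binormal form. -/
theorem ClusterSystem.IsBinormal.isExactDecomposition_id (hb : P.IsBinormal) :
    IsExactDecomposition P (Operator.id P) (Operator.id P) := by
  have := Operator.isOrean_closedForm_id (P := P)
  have him {X Y : C} (f : X ⟶ Y) := Operator.closedForm_id_im (P := P) f
  have hker {X Y : C} (f : X ⟶ Y) := Operator.closedForm_id_ker (P := P) f
  have hc : (Operator.id P).closedForm.IsConormal := fun X S => by
    obtain ⟨W, f, hf⟩ := hb.2 X S.1
    exact ⟨W, f, Subtype.ext ((him f).trans hf)⟩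
  have hn : (Operator.id P).closedForm.IsNormal := fun X S => by
    obtain ⟨W, f, hf⟩ := hb.1 X S.1
    exact ⟨W, f, Subtype.ext ((hker f).trans hf)⟩
  have hp : ((Operator.id P).projection fun _ => rfl).IsBinormal :=
    ⟨fun f => Subtype.ext (him f).symm, fun f => Subtype.ext (hker f).symm⟩
  exact
    { idem_s := fun _ => rfl
      idem_e := fun _ => rfl
      orean_s := this
      orean_e := this
      conormal_s := hc
      normal_e := hn
      -- Both operators are the identity, so every term other than the two constants would serve.
      exists_term := ⟨.fst, fun _ _ => rfl⟩
      projection_s := hp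
      projection_e := hp
      semiexact := ⟨hc, hn, ⟨Operator.id _, fun _ => rfl⟩, ⟨Operator.id _, fun _ => rfl⟩⟩
      inclusion_s := him
      inclusion_e := hker }

theorem ClusterSystem.IsBinormal.hasRightExactMeetDecomposition (hb : P.IsBinormal) :
    HasRightExactMeetDecomposition P :=
  ⟨_, _, hb.isExactDecomposition_id, fun _ _ => rfl, fun _ S => (inf_idem S).symm⟩

theorem HasRightExactMeetDecomposition.hasExactMeetDecomposition
    (h : HasRightExactMeetDecomposition P) : HasExactMeetDecomposition P :=
  let ⟨κs, κe, h, _, h'⟩ := h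
  ⟨κs, κe, h, h'⟩

theorem HasRightExactMeetDecomposition.isNormal (h : HasRightExactMeetDecomposition P) :
    P.IsNormal := by
  obtain ⟨κs, κe, h, hr, -⟩ := h
  have := h.orean_e
  intro X S
  obtain ⟨Y, g, hg⟩ := h.normal_e X ⟨κe.app S, h.idem_e S⟩
  refine ⟨Y, g, ?_⟩
  rw [← h.inclusion_e g, hg]
  exact (hr X S).symm

variable [HasZeroMorphisms C] [HasZeroObject C]

open scoped ZeroObject

/-- The first operator of an exact meet decomposition of a normal form is the identity. -/
theorem IsExactDecomposition.app_eq_self {κs κe : Operator P P}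
    (h : IsExactDecomposition P κs κe) (ht : IsDecomposingTerm P κs κe .inf) (hn : P.IsNormal)
    {X : C} (S : P.Cluster X) : κs.app S = S := by
  have := h.orean_s
  refine _root_.le_antisymm ?_ ?_
  · obtain ⟨Y, f, rfl⟩ := hn X S
    -- The bottom is the image of a map from the zero object, and images survive both the projection
    -- to `F_s` and the inclusion back.
    have hbot : κs.app (⊥ : P.Cluster Y) = ⊥ := by
      rw [← hn.im_from_zero (0 : 0 ⟶ Y)]
      exact (congrArg Subtype.val (h.projection_s.1 (0 : 0 ⟶ Y))).trans
        (h.inclusion_s (0 : 0 ⟶ Y))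
    have hker : κs.app (P.ker f) = (κs.closedForm.ker f).1 :=
      congrArg Subtype.val (h.projection_s.2 f)
    -- As the bottom of `F` lies in `F_s`, a kernel computed in `F_s` is sent below it, hence lies
    -- under the kernel computed in `F`.
    have hle : κs.closedForm.le f (κs.closedForm.ker f) ⟨⊥, hbot⟩ :=
      le_of_le_of_le' (le_ker_iff.1 le_rfl) bot_le
    rw [hker]
    exact le_ker_iff.2 hle
  · conv_lhs => rw [ht X S]
    exact inf_le_left

theorem HasExactMeetDecomposition.isConormal (h : HasExactMeetDecomposition P)
    (hn : P.IsNormal) : P.IsConormal := by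
  obtain ⟨κs, κe, h, ht⟩ := h
  have := h.orean_s
  intro X S
  obtain ⟨W, f, hf⟩ := h.conormal_s X ⟨S, h.app_eq_self ht hn S⟩
  refine ⟨W, f, ?_⟩
  rw [← h.inclusion_s f, hf]
  rfl

end Decomposition

end FormTheory

open FormTheory FormTheory.ClusterSystem in
theorem mainTheorem9 {C : Type u} [Category.{v} C] [HasZeroMorphisms C] [HasZeroObject C]
    {B : Type u₁} [Category.{v₁} B] (F : B ⥤ C) [FormTheory.IsForm F]
    [(FormTheory.clusters F).IsOrean] :
    (FormTheory.IsPuppeMitchellExact C ↔ ∃ N : MorphismProperty C, FormTheory.IsGrandisExact N) ∧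
    List.TFAE [
      -- (i), in the terms of Puppe and Mitchell
      FormTheory.IsPuppeMitchellExact C ∧
        Nonempty ((FormTheory.clusters F).Iso (FormTheory.normalSubobjectForm C)),
      -- (i), in the terms of Grandis
      ∃ N : MorphismProperty C, FormTheory.IsGrandisExact N ∧
        Nonempty ((FormTheory.clusters F).Iso
          (FormTheory.subobjectForm (FormTheory.nullKernels N))),
      -- (ii)
      (FormTheory.clusters F).IsBinormal ∧ (FormTheory.clusters F).IsNoetherian,
      -- (iii)
      (FormTheory.clusters F).IsNormal ∧ (FormTheory.clusters F).IsNoetherian ∧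
        FormTheory.HasExactMeetDecomposition (FormTheory.clusters F),
      -- (iv)
      (FormTheory.clusters F).IsNoetherian ∧
        FormTheory.HasRightExactMeetDecomposition (FormTheory.clusters F),
      -- (v)
      (FormTheory.clusters F).AxiomN2 ∧
        FormTheory.HasRightExactMeetDecomposition (FormTheory.clusters F),
      -- (vi)
      (FormTheory.clusters F).IsNormal ∧ (FormTheory.clusters F).AxiomN2 ∧
        FormTheory.HasExactMeetDecomposition (FormTheory.clusters F),
      -- (vii)
      (FormTheory.clusters F).IsBinormal ∧ (FormTheory.clusters F).AxiomN2] := by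
  refine ⟨isPuppeMitchellExact_iff_exists_isGrandisExact, ?_⟩
  tfae_have 1 ↔ 2 := isPuppeMitchellExact_and_iso_iff _
  -- Condition (i) occupies two entries, so the numbering is shifted by one from there on: entry 8
  -- is (vii).
  tfae_have 1 → 8 := by
    rw [← isGrandisExact_zeroMorphisms_iff, ← subobjectForm_nullKernels_zeroMorphisms]
    exact fun ⟨h, ⟨i⟩⟩ => isBinormal_and_axiomN2_of_iso h i
  tfae_have 8 → 1 := by
    rw [← isGrandisExact_zeroMorphisms_iff, ← subobjectForm_nullKernels_zeroMorphisms]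
    exact fun ⟨hb, h⟩ => ⟨hb.isGrandisExact h, hb.nonempty_iso h⟩
  tfae_have 8 → 3 := fun ⟨hb, h⟩ => ⟨hb, hb.isNoetherian h⟩
  tfae_have 3 → 4 := fun ⟨hb, h⟩ =>
    ⟨hb.1, h, hb.hasRightExactMeetDecomposition.hasExactMeetDecomposition⟩
  tfae_have 3 → 5 := fun ⟨hb, h⟩ => ⟨h, hb.hasRightExactMeetDecomposition⟩
  tfae_have 5 → 6 := fun ⟨h, hd⟩ => ⟨h.n2, hd⟩
  tfae_have 6 → 7 := fun ⟨h, hd⟩ => ⟨hd.isNormal, h, hd.hasExactMeetDecomposition⟩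
  tfae_have 4 → 7 := fun ⟨hn, h, hd⟩ => ⟨hn, h.n2, hd⟩
  tfae_have 7 → 8 := fun ⟨hn, h, hd⟩ => ⟨⟨hn, hd.isConormal hn⟩, h⟩
  tfae_finish
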